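/- **Setting.** Let $\mu$ be Lebesgue measure on $\mathbb R^3$, and let $\mathcal P_>$ be the set of ($\mu$-a.e. classes of) probability densities that are positive $\mu$-a.e. Let $\Phi(y)=\cosh y-1$ and $\Phi_*(x)=|x|\sinh^{-1}|x|-\sqrt{1+x^2}+1$. For $p\in\mathcal P_>$ and $\Psi\in\{\Phi,\Phi_*\}$, let $L^{\Psi}(p)$ be the Orlicz space of (classes of) measurable functions $u$ with $\int\Psi(\alpha u)\,p\,d\mu<\infty$ for some $\alpha>0$, with the Luxemburg norm (whose closed unit ball is $\{u:\int\Psi(u)\,p\,d\mu\le 1\}$), and let $L^{\Psi}_0(p)=\{u\in L^{\Psi}(p):\int u\,p\,d\mu=0\}$. For $u\in L^\Phi_0(p)$ put $K_p(u)=\log\int e^{u}\,p\,d\mu\in[0,+\infty]$, and let $\mathcal S_p$ be the topological interior, in $L^{\Phi}_0(p)$, of $\{u : K_p(u)<+\infty\}$. The maximal exponential model at $p$ is $\mathcal E(p)=\{e^{u-K_p(u)}\,p : u\in\mathcal S_p\}\subset\mathcal P_>$. The pretangent bundle is ${}^*T\mathcal P_>=\{(q,v): q\in\mathcal P_>,\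 v\in L^{\Phi_*}_0(q)\}$, and a vector field of it over $\mathcal E(p)$ is a section, i.e. a map $q\mapsto (q,F(q))$ on $\mathcal E(p)$ with $F(q)\in L^{\Phi_*}_0(q)$ for every $q$. Let $\sigma$ be the uniform probability measure on the unit sphere $S^2\subset\mathbb R^3$. For $x\in S^2$ and $v,w\in\mathbb R^3$ write $v_x=v-(x\cdot(v-w))\,x$ and $w_x=w+(x\cdot(v-w))\,x$. The Boltzmann operator is $$Q(f)(v)=\int_{\mathbb R^3}\int_{S^2}\bigl(f(v_x)f(w_x)-f(v)f(w)\bigr)\,|x\cdot(v-w)|\;\sigma(dx)\,dw .$$ **Proposition (Boltzmann field).** Let $f_0(v)=(2\pi)^{-3/2}e^{-|v|^2/2}$ and let $f\in\mathcal E(f_0)$. Then the integral defining $Q(f)(v)$ converges absolutely for almost every $v$, $Q(f)$ does not depend, up to a.e. equality, on the choice of the representative of $f$, and $$\frac{Q(f)}{f}\in L^{\Phi_*}_0(f).$$ Consequently $f\mapsto Q(f)/f$ is a vector field of the pretangent bundle over $\mathcal E(f_0)$. -/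

import Mathlib

open MeasureTheory

noncomputable section

namespace InfoGeom

/-! ## Young functions -/

/-- A real Young function: finite, convex, even, vanishing exactly at `0`. -/
structure YoungFunction where
  toFun : ℝ → ℝ
  convexOn' : ConvexOn ℝ Set.univ toFun
  even' : ∀ x, toFun (-x) = toFun x
  map_zero' : toFun 0 = 0
  pos' : ∀ x, x ≠ 0 → 0 < toFun x

instance : CoeFun YoungFunction (fun _ => ℝ → ℝ) := ⟨YoungFunction.toFun⟩

theorem YoungFunction.nonneg (Φ : YoungFunction) (x : ℝ) : 0 ≤ Φ x := by
  by_cases h : x = 0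
  · rw [h, Φ.map_zero']
  · exact (Φ.pos' x h).le

theorem YoungFunction.continuous (Φ : YoungFunction) : Continuous Φ :=
  continuousOn_univ.1 (Φ.convexOn'.continuousOn isOpen_univ)

theorem YoungFunction.map_smul_le (Φ : YoungFunction) {t : ℝ} (h0 : 0 ≤ t) (h1 : t ≤ 1) (x : ℝ) :
    Φ (t * x) ≤ t * Φ x := by
  have h := Φ.convexOn'.2 (Set.mem_univ x) (Set.mem_univ 0) h0 (sub_nonneg.2 h1) (by ring)
  simpa [Φ.map_zero'] using h

theorem YoungFunction.map_abs (Φ : YoungFunction) (x : ℝ) : Φ |x| = Φ x := by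
  rcases abs_choice x with h | h <;> rw [h]
  exact Φ.even' x

theorem YoungFunction.map_mul_le (Φ : YoungFunction) {t : ℝ} (h1 : |t| ≤ 1) (x : ℝ) :
    Φ (t * x) ≤ |t| * Φ x := by
  rw [← Φ.map_abs (t * x), abs_mul, ← Φ.map_abs x]
  exact Φ.map_smul_le (abs_nonneg t) h1 |x|

/-- The Young function `Φ(y) = cosh y - 1`. -/
def youngCosh : YoungFunction where
  toFun y := Real.cosh y - 1
  convexOn' := by
    apply Monotone.convexOn_univ_of_deriv
    · exact Real.differentiable_cosh.sub_const 1
    · have : deriv (fun y => Real.cosh y - 1) = Real.sinh := by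
        funext y
        exact ((Real.hasDerivAt_cosh y).sub_const 1).deriv
      rw [this]
      exact Real.sinh_strictMono.monotone
  even' x := by rw [Real.cosh_neg]
  map_zero' := by simp
  pos' x hx := sub_pos.2 (Real.one_lt_cosh.2 hx)

/-- The auxiliary function `|x| arsinh |x| - √(1 + x²) + 1`. -/
def coshConj (x : ℝ) : ℝ := |x| * Real.arsinh |x| - √(1 + x ^ 2) + 1

theorem coshConj_eq (x : ℝ) : coshConj x = x * Real.arsinh x - √(1 + x ^ 2) + 1 := by
  unfold coshConj
  rcases abs_choice x with h | h <;> rw [h]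
  rw [Real.arsinh_neg]; ring

theorem hasDerivAt_coshConj (x : ℝ) : HasDerivAt coshConj (Real.arsinh x) x := by
  have hpos : 0 < 1 + x ^ 2 := by positivity
  have h1 := (hasDerivAt_id' x).mul (Real.hasDerivAt_arsinh x)
  have h2 : HasDerivAt (fun y : ℝ => 1 + y ^ 2) (2 * x) x := by
    simpa using (hasDerivAt_pow 2 x).const_add 1
  have h3 := (h1.sub (h2.sqrt hpos.ne')).add_const 1
  have e : coshConj = fun y => y * Real.arsinh y - √(1 + y ^ 2) + 1 := funext coshConj_eq
  rw [e]
  have h4 : 2 * x / (2 * √(1 + x ^ 2)) = x * (√(1 + x ^ 2))⁻¹ := by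
    rw [mul_div_mul_left _ _ two_ne_zero, div_eq_mul_inv]
  rw [h4, one_mul, add_sub_cancel_right] at h3
  exact h3

theorem deriv_coshConj : deriv coshConj = Real.arsinh :=
  funext fun x => (hasDerivAt_coshConj x).deriv

/-- The Young function `Φ_*(x) = |x| arsinh |x| - √(1 + x²) + 1`, conjugate to `cosh - 1`. -/
def youngCoshStar : YoungFunction where
  toFun := coshConj
  convexOn' := by
    apply Monotone.convexOn_univ_of_deriv (fun x => (hasDerivAt_coshConj x).differentiableAt)
    rw [deriv_coshConj]
    exact Real.arsinh_strictMono.monotone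
  even' x := by simp [coshConj]
  map_zero' := by simp [coshConj]
  pos' x hx := by
    have hmono : StrictMonoOn coshConj (Set.Ici 0) := by
      apply strictMonoOn_of_deriv_pos (convex_Ici 0)
      · exact fun y _ => (hasDerivAt_coshConj y).continuousAt.continuousWithinAt
      · intro y hy
        rw [interior_Ici] at hy
        rw [deriv_coshConj]
        exact Real.arsinh_pos_iff.2 hy
    have h := hmono (Set.mem_Ici.2 le_rfl) (Set.mem_Ici.2 (abs_nonneg x)) (abs_pos.2 hx)
    simpa [coshConj] using h

/-! ## Orlicz spaces -/

section Orlicz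

variable {Ω : Type*} [MeasurableSpace Ω]

/-- The modular `∫ Φ(u) dP`, with values in `[0, ∞]`. -/
def modular (Φ : YoungFunction) (P : Measure Ω) (u : Ω → ℝ) : ENNReal :=
  ∫⁻ ω, ENNReal.ofReal (Φ (u ω)) ∂P

theorem modular_congr (Φ : YoungFunction) {P : Measure Ω} {u v : Ω → ℝ} (h : u =ᵐ[P] v) :
    modular Φ P u = modular Φ P v :=
  lintegral_congr_ae (h.mono fun ω hω => by simp only [hω])

theorem modular_smul_le (Φ : YoungFunction) (P : Measure Ω) (u : Ω → ℝ) {t : ℝ} (ht : |t| ≤ 1) :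
    modular Φ P (fun ω => t * u ω) ≤ ENNReal.ofReal |t| * modular Φ P u := by
  unfold modular
  rw [← lintegral_const_mul' _ _ ENNReal.ofReal_ne_top]
  refine lintegral_mono fun ω => ?_
  rw [← ENNReal.ofReal_mul (abs_nonneg t)]
  exact ENNReal.ofReal_le_ofReal (Φ.map_mul_le ht _)

theorem modular_convex (Φ : YoungFunction) {P : Measure Ω} {u v : Ω → ℝ}
    (hu : AEMeasurable u P) {a b : ℝ} (ha : 0 ≤ a) (hb : 0 ≤ b)
    (hab : a + b = 1) :
    modular Φ P (fun ω => a * u ω + b * v ω) ≤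
      ENNReal.ofReal a * modular Φ P u + ENNReal.ofReal b * modular Φ P v := by
  unfold modular
  have hm : AEMeasurable (fun ω => ENNReal.ofReal a * ENNReal.ofReal (Φ (u ω))) P :=
    ((Φ.continuous.measurable.comp_aemeasurable hu).ennreal_ofReal).const_mul _
  rw [← lintegral_const_mul' _ _ ENNReal.ofReal_ne_top,
    ← lintegral_const_mul' _ _ ENNReal.ofReal_ne_top, ← lintegral_add_left' hm]
  refine lintegral_mono fun ω => ?_
  rw [← ENNReal.ofReal_mul ha, ← ENNReal.ofReal_mul hb,
    ← ENNReal.ofReal_add (mul_nonneg ha (Φ.nonneg _)) (mul_nonneg hb (Φ.nonneg _))]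
  exact ENNReal.ofReal_le_ofReal (Φ.convexOn'.2 (Set.mem_univ _) (Set.mem_univ _) ha hb hab)

/-- The Orlicz class as a subspace of the a.e. classes of measurable functions:
`u` belongs to it iff `∫ Φ(α u) dP < ∞` for some `α > 0`. -/
def orliczSubmodule (Φ : YoungFunction) (P : Measure Ω) : Submodule ℝ (Ω →ₘ[P] ℝ) where
  carrier := {u | ∃ α : ℝ, 0 < α ∧ modular Φ P (fun ω => α * u ω) < ⊤}
  zero_mem' := by
    refine ⟨1, one_pos, ?_⟩
    have : (fun ω => (1 : ℝ) * (0 : Ω →ₘ[P] ℝ) ω) =ᵐ[P] fun _ => 0 :=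
      AEEqFun.coeFn_zero.mono fun ω h => (one_mul _).trans h
    rw [modular_congr Φ this]
    simp [modular, Φ.map_zero']
  add_mem' := by
    rintro u v ⟨α, hα, hu⟩ ⟨β, hβ, hv⟩
    refine ⟨min α β / 2, by positivity, ?_⟩
    have key : ∀ (γ : ℝ) (w : Ω → ℝ), 0 < γ → min α β ≤ γ →
        modular Φ P (fun ω => γ * w ω) < ⊤ → modular Φ P (fun ω => min α β * w ω) < ⊤ := by
      intro γ w hγ hle hw
      have ht : |min α β / γ| ≤ 1 := by
        rw [abs_of_nonneg (by positivity)]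
        exact (div_le_one hγ).2 hle
      have h := modular_smul_le Φ P (fun ω => γ * w ω) ht
      have e : (fun ω => min α β / γ * (γ * w ω)) = fun ω => min α β * w ω := by
        funext ω
        field_simp
      rw [e] at h
      exact h.trans_lt (ENNReal.mul_lt_top ENNReal.ofReal_lt_top hw)
    have hu' := key α u hα (min_le_left _ _) hu
    have hv' := key β v hβ (min_le_right _ _) hv
    have e : (fun ω => min α β / 2 * (u + v : Ω →ₘ[P] ℝ) ω) =ᵐ[P]
        fun ω => (1 / 2) * (min α β * u ω) + (1 / 2) * (min α β * v ω) :=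
      (AEEqFun.coeFn_add u v).mono fun ω h => by
        simp only [h, Pi.add_apply]
        ring
    rw [modular_congr Φ e]
    refine (modular_convex Φ (u.aemeasurable.const_mul _)
      (by norm_num) (by norm_num) (by norm_num)).trans_lt ?_
    exact ENNReal.add_lt_top.2 ⟨ENNReal.mul_lt_top ENNReal.ofReal_lt_top hu',
      ENNReal.mul_lt_top ENNReal.ofReal_lt_top hv'⟩
  smul_mem' := by
    rintro c u ⟨α, hα, hu⟩
    refine ⟨α / (|c| + 1), by positivity, ?_⟩
    have e : (fun ω => α / (|c| + 1) * (c • u : Ω →ₘ[P] ℝ) ω) =ᵐ[P]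
        fun ω => c / (|c| + 1) * (α * u ω) :=
      (AEEqFun.coeFn_smul c u).mono fun ω h => by
        simp only [h, Pi.smul_apply, smul_eq_mul]
        ring
    rw [modular_congr Φ e]
    have hc : |c / (|c| + 1)| ≤ 1 := by
      rw [abs_div, abs_of_pos (by positivity : 0 < |c| + 1)]
      exact (div_le_one (by positivity)).2 (by linarith)
    exact (modular_smul_le Φ P _ hc).trans_lt (ENNReal.mul_lt_top ENNReal.ofReal_lt_top hu)

/-- The Orlicz space `L^Φ(P)`. -/
def OrliczSpace (Φ : YoungFunction) (P : Measure Ω) : Type _ := ↥(orliczSubmodule Φ P)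

namespace OrliczSpace

variable {Φ : YoungFunction} {P : Measure Ω}

instance : AddCommGroup (OrliczSpace Φ P) := inferInstanceAs (AddCommGroup ↥(orliczSubmodule Φ P))

instance : Module ℝ (OrliczSpace Φ P) := inferInstanceAs (Module ℝ ↥(orliczSubmodule Φ P))

/-- The a.e. class underlying an element of the Orlicz space. -/
def toAEEqFun (u : OrliczSpace Φ P) : Ω →ₘ[P] ℝ := Subtype.val (p := (· ∈ orliczSubmodule Φ P)) u

instance : CoeFun (OrliczSpace Φ P) (fun _ => Ω → ℝ) := ⟨fun u => (u.toAEEqFun : Ω → ℝ)⟩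

/-- An a.e. class with finite modular after scaling, as an element of the Orlicz space. -/
def mk (u : Ω →ₘ[P] ℝ) (h : ∃ α : ℝ, 0 < α ∧ modular Φ P (fun ω => α * u ω) < ⊤) :
    OrliczSpace Φ P := (⟨u, h⟩ : ↥(orliczSubmodule Φ P))

@[simp] theorem toAEEqFun_mk (u : Ω →ₘ[P] ℝ)
    (h : ∃ α : ℝ, 0 < α ∧ modular Φ P (fun ω => α * u ω) < ⊤) :
    (mk (Φ := Φ) u h).toAEEqFun = u := rfl

theorem exists_modular_lt_top (u : OrliczSpace Φ P) :
    ∃ α : ℝ, 0 < α ∧ modular Φ P (fun ω => α * u ω) < ⊤ :=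
  Subtype.prop (p := (· ∈ orliczSubmodule Φ P)) u

theorem coeFn_add (u v : OrliczSpace Φ P) : ⇑(u + v) =ᵐ[P] fun ω => u ω + v ω :=
  AEEqFun.coeFn_add u.toAEEqFun v.toAEEqFun

theorem coeFn_smul (c : ℝ) (u : OrliczSpace Φ P) : ⇑(c • u) =ᵐ[P] fun ω => c * u ω :=
  AEEqFun.coeFn_smul c u.toAEEqFun

theorem coeFn_zero : ⇑(0 : OrliczSpace Φ P) =ᵐ[P] fun _ => 0 :=
  AEEqFun.coeFn_zero

theorem aemeasurable (u : OrliczSpace Φ P) : AEMeasurable u P := u.toAEEqFun.aemeasurable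

variable (Φ P) in
/-- The set `{u | ∫ Φ(u) dP ≤ 1}`, which is the closed unit ball of the Luxemburg norm. -/
def unitBall : Set (OrliczSpace Φ P) := {u | modular Φ P u ≤ 1}

theorem convex_unitBall : Convex ℝ (unitBall Φ P) := by
  intro u hu v hv a b ha hb hab
  have e : ⇑(a • u + b • v) =ᵐ[P] fun ω => a * u ω + b * v ω := by
    filter_upwards [coeFn_add (a • u) (b • v), coeFn_smul a u, coeFn_smul b v] with ω h1 h2 h3
    rw [h1, h2, h3]
  change modular Φ P _ ≤ 1
  rw [modular_congr Φ e]
  refine (modular_convex Φ u.aemeasurable ha hb hab).trans ?_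
  calc _ ≤ ENNReal.ofReal a * 1 + ENNReal.ofReal b * 1 := by
        gcongr
        · exact hu
        · exact hv
    _ = 1 := by rw [mul_one, mul_one, ← ENNReal.ofReal_add ha hb, hab, ENNReal.ofReal_one]

theorem smul_mem_unitBall {u : OrliczSpace Φ P} (hu : u ∈ unitBall Φ P) {c : ℝ} (hc : |c| ≤ 1) :
    c • u ∈ unitBall Φ P := by
  change modular Φ P _ ≤ 1
  rw [modular_congr Φ (coeFn_smul c u)]
  refine (modular_smul_le Φ P u hc).trans ?_
  calc _ ≤ ENNReal.ofReal 1 * 1 := by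
        gcongr
        exact hu
    _ = 1 := by simp

theorem balanced_unitBall : Balanced ℝ (unitBall Φ P) := by
  rintro c hc _ ⟨u, hu, rfl⟩
  exact smul_mem_unitBall hu hc

theorem exists_smul_mem_unitBall (u : OrliczSpace Φ P) :
    ∃ c : ℝ, 0 < c ∧ c • u ∈ unitBall Φ P := by
  obtain ⟨α, hα, hu⟩ := u.exists_modular_lt_top
  set m := (modular Φ P (fun ω => α * u ω)).toReal with hm
  have hm0 : 0 ≤ m := ENNReal.toReal_nonneg
  refine ⟨1 / (m + 1) * α, by positivity, ?_⟩
  change modular Φ P _ ≤ 1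
  have e : ⇑((1 / (m + 1) * α) • u) =ᵐ[P] fun ω => 1 / (m + 1) * (α * u ω) :=
    (coeFn_smul _ u).mono fun ω h => by rw [h]; ring
  rw [modular_congr Φ e]
  have ht : |1 / (m + 1)| ≤ 1 := by
    rw [abs_of_pos (by positivity)]
    exact (div_le_one (by positivity)).2 (by linarith)
  refine (modular_smul_le Φ P _ ht).trans ?_
  rw [← ENNReal.ofReal_toReal hu.ne, ← hm, ← ENNReal.ofReal_mul (abs_nonneg _),
    abs_of_pos (by positivity)]
  refine ENNReal.ofReal_le_one.2 ?_
  rw [one_div, inv_mul_eq_div]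
  exact (div_le_one (by positivity)).2 (by linarith)

theorem absorbent_unitBall : Absorbent ℝ (unitBall Φ P) := by
  intro u
  obtain ⟨c, hc, hu⟩ := exists_smul_mem_unitBall u
  refine absorbs_iff_norm.2 ⟨c⁻¹, fun k hk => ?_⟩
  have hk0 : 0 < ‖k‖ := (inv_pos.2 hc).trans_le hk
  have hkne : k ≠ 0 := norm_pos_iff.1 hk0
  rw [Set.singleton_subset_iff, Set.mem_smul_set_iff_inv_smul_mem₀ hkne]
  have e : k⁻¹ • u = (k⁻¹ * c⁻¹) • (c • u) := by
    rw [smul_smul, mul_assoc, inv_mul_cancel₀ hc.ne', mul_one]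
  rw [e]
  refine smul_mem_unitBall hu ?_
  rw [abs_mul, abs_inv, abs_of_pos (inv_pos.2 hc), inv_mul_eq_div]
  exact (div_le_one hk0).2 hk

variable (Φ P) in
/-- The Luxemburg norm `‖u‖ = inf {r > 0 | ∫ Φ(u / r) dP ≤ 1}`, as a seminorm. -/
def luxemburg : Seminorm ℝ (OrliczSpace Φ P) :=
  gaugeSeminorm balanced_unitBall convex_unitBall absorbent_unitBall

theorem luxemburg_apply (u : OrliczSpace Φ P) :
    luxemburg Φ P u = sInf {r : ℝ | 0 < r ∧ modular Φ P (fun ω => r⁻¹ * u ω) ≤ 1} := by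
  change gauge (unitBall Φ P) u = _
  rw [gauge_def']
  congr 1
  ext r
  change (0 < r ∧ modular Φ P (⇑(r⁻¹ • u : OrliczSpace Φ P)) ≤ 1) ↔
    (0 < r ∧ modular Φ P (fun ω => r⁻¹ * u ω) ≤ 1)
  rw [modular_congr Φ (coeFn_smul r⁻¹ u)]

theorem eq_zero_of_luxemburg_eq_zero (u : OrliczSpace Φ P) (h : luxemburg Φ P u = 0) : u = 0 := by
  have hle : ∀ r : ℝ, 0 < r → r ≤ 1 → modular Φ P u ≤ ENNReal.ofReal r := by
    intro r hr hr1
    have hlt : gauge (unitBall Φ P) u < r := by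
      change luxemburg Φ P u < r
      rw [h]; exact hr
    obtain ⟨s, hs0, hsr, v, hv, rfl⟩ := exists_lt_of_gauge_lt absorbent_unitBall hlt
    have hs1 : |s| ≤ 1 := by rw [abs_of_pos hs0]; linarith
    change modular Φ P (⇑(s • v : OrliczSpace Φ P)) ≤ _
    rw [modular_congr Φ (coeFn_smul s v)]
    refine (modular_smul_le Φ P v hs1).trans ?_
    rw [abs_of_pos hs0]
    calc _ ≤ ENNReal.ofReal s * 1 := by
          gcongr
          exact hv
      _ ≤ ENNReal.ofReal r := by
          rw [mul_one]
          exact ENNReal.ofReal_le_ofReal hsr.le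
  have h0 : modular Φ P u = 0 := by
    by_contra hne
    obtain ⟨r, hr0, hr1⟩ := ENNReal.lt_iff_exists_nnreal_btwn.1 (pos_iff_ne_zero.2 hne)
    have hr : 0 < min (r : ℝ) 1 := lt_min (by exact_mod_cast hr0) one_pos
    have h1 := hle _ hr (min_le_right _ _)
    have h2 : ENNReal.ofReal (min (r : ℝ) 1) ≤ r := by
      refine (ENNReal.ofReal_le_ofReal (min_le_left _ _)).trans ?_
      simp
    exact absurd (h1.trans h2) (not_le.2 hr1)
  have hmeas : AEMeasurable (fun ω => ENNReal.ofReal (Φ (u ω))) P :=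
    (Φ.continuous.measurable.comp_aemeasurable u.aemeasurable).ennreal_ofReal
  have hae := (lintegral_eq_zero_iff' hmeas).1 h0
  apply Subtype.ext
  refine AEEqFun.ext ?_
  have hz : ⇑(0 : OrliczSpace Φ P) =ᵐ[P] fun _ => 0 := coeFn_zero
  filter_upwards [hae, hz] with ω h1 h2
  refine Eq.trans ?_ h2.symm
  by_contra hne
  exact absurd (ENNReal.ofReal_eq_zero.1 h1) (not_le.2 (Φ.pos' _ hne))

instance : NormedAddCommGroup (OrliczSpace Φ P) :=
  AddGroupNorm.toNormedAddCommGroup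
    { toFun := luxemburg Φ P
      map_zero' := map_zero _
      add_le' := map_add_le_add _
      neg' := map_neg_eq_map _
      eq_zero_of_map_eq_zero' := eq_zero_of_luxemburg_eq_zero }

theorem norm_def (u : OrliczSpace Φ P) : ‖u‖ = luxemburg Φ P u := rfl

instance : NormedSpace ℝ (OrliczSpace Φ P) where
  norm_smul_le c u := (map_smul_eq_mul (luxemburg Φ P) c u).le

end OrliczSpace

/-- The centered Orlicz space `L^Φ_0(P) = {u ∈ L^Φ(P) | ∫ u dP = 0}`, with the Luxemburg norm
inherited from `L^Φ(P)`. -/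
def centeredOrlicz (Φ : YoungFunction) (P : Measure Ω) : Submodule ℝ (OrliczSpace Φ P) where
  carrier := {u | Integrable u P ∧ ∫ ω, u ω ∂P = 0}
  zero_mem' := by
    refine ⟨(integrable_congr OrliczSpace.coeFn_zero).2 (integrable_zero _ _ _), ?_⟩
    rw [integral_congr_ae OrliczSpace.coeFn_zero, integral_zero]
  add_mem' := by
    rintro u v ⟨hu, hu0⟩ ⟨hv, hv0⟩
    refine ⟨(integrable_congr (OrliczSpace.coeFn_add u v)).2 (hu.add hv), ?_⟩
    rw [integral_congr_ae (OrliczSpace.coeFn_add u v), integral_add hu hv, hu0, hv0, add_zero]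
  smul_mem' := by
    rintro c u ⟨hu, hu0⟩
    refine ⟨(integrable_congr (OrliczSpace.coeFn_smul c u)).2 (hu.const_mul c), ?_⟩
    rw [integral_congr_ae (OrliczSpace.coeFn_smul c u), integral_const_mul, hu0, mul_zero]

end Orlicz

/-! ## Positive densities, maximal exponential models, the pretangent bundle -/

section Manifold

variable {Ω : Type*} [MeasurableSpace Ω]

/-- The set of a.e. classes of probability densities with respect to `μ` that are positive
`μ`-almost everywhere. -/
structure PosDensity (μ : Measure Ω) where
  toAEEqFun : Ω →ₘ[μ] ℝ
  pos : ∀ᵐ ω ∂μ, 0 < toAEEqFun ω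
  lintegral_eq_one : ∫⁻ ω, ENNReal.ofReal (toAEEqFun ω) ∂μ = 1

variable {μ : Measure Ω}

instance : CoeFun (PosDensity μ) (fun _ => Ω → ℝ) := ⟨fun p => (p.toAEEqFun : Ω → ℝ)⟩

/-- The probability measure `p · μ`. -/
def PosDensity.measure (p : PosDensity μ) : Measure Ω :=
  μ.withDensity fun ω => ENNReal.ofReal (p ω)

/-- The model space `B_p = L^Φ_0(p)`, with `Φ = cosh - 1`. -/
abbrev ExpSpace (p : PosDensity μ) : Type _ := ↥(centeredOrlicz youngCosh p.measure)

/-- The space `L^{Φ_*}_0(p)`, the fiber of the pretangent bundle at `p`. -/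
abbrev PretangentSpace (p : PosDensity μ) : Type _ := ↥(centeredOrlicz youngCoshStar p.measure)

/-- The cumulant generating functional `K_p(u) = log E_p[e^u]`, possibly `+∞`. -/
def cumulant (p : PosDensity μ) (u : ExpSpace p) : EReal :=
  ENNReal.log (∫⁻ ω, ENNReal.ofReal (Real.exp (u.1 ω)) ∂p.measure)

/-- `S_p`: the topological interior in `B_p` of the proper domain of `K_p`. -/
def cumulantDomain (p : PosDensity μ) : Set (ExpSpace p) :=
  interior {u | cumulant p u < ⊤}

/-- The maximal exponential model at `p`: all densities `e^{u - K_p(u)} · p` with `u ∈ S_p`. -/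
def maxExp (p : PosDensity μ) : Set (PosDensity μ) :=
  {q | ∃ u ∈ cumulantDomain p,
    q =ᵐ[μ] fun ω => Real.exp (u.1 ω - (cumulant p u).toReal) * p ω}

variable (μ) in
/-- The (total space of the) pretangent bundle: all pairs `(q, v)` with `v ∈ L^{Φ_*}_0(q)`. -/
abbrev PretangentBundle : Type _ := Σ q : PosDensity μ, PretangentSpace q

/-- A vector field of the pretangent bundle over a set `M` of positive densities: a section. -/
structure PretangentField (M : Set (PosDensity μ)) where
  toFun : M → PretangentBundle μ
  proj : ∀ q : M, (toFun q).1 = q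

end Manifold

/-! ## The Boltzmann operator -/

/-- The space of velocities. -/
abbrev Vel : Type := EuclideanSpace ℝ (Fin 3)

/-- The unit sphere `S²`. -/
abbrev S2 : Type := Metric.sphere (0 : Vel) 1

/-- The uniform probability measure on `S²` (normalized surface measure). -/
def sphereUnif : Measure S2 :=
  ((volume : Measure Vel).toSphere Set.univ)⁻¹ • (volume : Measure Vel).toSphere

instance : IsProbabilityMeasure sphereUnif := by
  constructor
  rw [sphereUnif, Measure.smul_apply, smul_eq_mul]
  refine ENNReal.inv_mul_cancel ?_ (measure_ne_top _ _)
  rw [Measure.toSphere_apply_univ]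
  refine mul_ne_zero ?_ (Metric.measure_ball_pos _ _ one_pos).ne'
  simp

/-- The velocity `v_x = v - x x'(v - w)`. -/
def collV (x v w : Vel) : Vel := v - inner ℝ x (v - w) • x

/-- The velocity `w_x = w + x x'(v - w)`. -/
def collW (x v w : Vel) : Vel := w + inner ℝ x (v - w) • x

/-- The integrand `(f(v_x) f(w_x) - f(v) f(w)) |x'(v - w)|` of the Boltzmann operator. -/
def boltzmannIntegrand (f : Vel → ℝ) (v w x : Vel) : ℝ :=
  (f (collV x v w) * f (collW x v w) - f v * f w) * |inner ℝ x (v - w)|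

/-- The Boltzmann operator
`Q(f)(v) = ∫ dw ∫ σ(dx) (f(v_x) f(w_x) - f(v) f(w)) |x'(v - w)|`. -/
def boltzmannQ (f : Vel → ℝ) (v : Vel) : ℝ :=
  ∫ w : Vel, ∫ x : S2, boltzmannIntegrand f v w x ∂sphereUnif

/-- The standard normal density on `ℝ³`. -/
def stdNormal (v : Vel) : ℝ := (2 * Real.pi) ^ (-(3 / 2) : ℝ) * Real.exp (-‖v‖ ^ 2 / 2)

theorem stdNormal_pos (v : Vel) : 0 < stdNormal v := by
  unfold stdNormal
  positivity

theorem continuous_stdNormal : Continuous stdNormal := by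
  unfold stdNormal
  fun_prop

theorem integral_stdNormal : ∫ v, stdNormal v = 1 := by
  unfold stdNormal
  rw [integral_const_mul]
  have h := GaussianFourier.integral_rexp_neg_mul_sq_norm (V := Vel) (b := 1 / 2) (by norm_num)
  have e : (fun v : Vel => Real.exp (-‖v‖ ^ 2 / 2)) =
      fun v : Vel => Real.exp (-(1 / 2) * ‖v‖ ^ 2) := by
    funext v
    congr 1
    ring
  rw [e, h, finrank_euclideanSpace_fin]
  have hp : Real.pi / (1 / 2) = 2 * Real.pi := by ring
  rw [hp, ← Real.rpow_add (by positivity)]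
  norm_num

theorem lintegral_stdNormal : ∫⁻ v, ENNReal.ofReal (stdNormal v) = 1 := by
  have hi : Integrable stdNormal := by
    by_contra h
    have := integral_undef h
    rw [integral_stdNormal] at this
    exact one_ne_zero this
  rw [← ofReal_integral_eq_lintegral_ofReal hi (ae_of_all _ fun v => (stdNormal_pos v).le),
    integral_stdNormal, ENNReal.ofReal_one]

/-- The standard normal density as a point of the set of positive densities on `ℝ³`. -/
def maxwellian : PosDensity (volume : Measure Vel) where
  toAEEqFun := AEEqFun.mk stdNormal continuous_stdNormal.aestronglyMeasurable
  pos := (AEEqFun.coeFn_mk stdNormal _).mono fun v hv => by rw [hv]; exact stdNormal_pos v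
  lintegral_eq_one := by
    rw [← lintegral_stdNormal]
    exact lintegral_congr_ae ((AEEqFun.coeFn_mk stdNormal
      continuous_stdNormal.aestronglyMeasurable).mono fun v hv => by simp only [hv])

end InfoGeom

end

open InfoGeom

/-!
The density `f` is a.e. equal to `φ = e^U ρ`, where `ρ` is the standard normal density. Because the
domain of the cumulant functional is taken open, `e^U` has a moment of order `1 + 1 / m` under `ρ`
for some `m`, and because `U` differs by a constant from an element of `L^Φ(ρ)`, `|U|` has an
exponential moment (`exists_expMoments_of_mem_maxExp`).

The collision map `(v, w, x) ↦ (v_x, w_x, x)` is an involution which preserves the measure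
`dv dw σ(dx)` (`measurePreserving_collide`), the kernel `|x'(v - w)|`, and, by conservation of
energy, the product `ρ ⊗ ρ`. Hence, if `a` has enough moments under `ρ`, so has `a(v_x)` under
`ρ ⊗ ρ ⊗ σ`, and Hölder's inequality bounds the integral of `a(v_x) |x'(v - w)|` against `φ ⊗ φ`.
A change of variables turns this into the integrability of `a(v) φ(v_x) φ(w_x) |x'(v - w)|`
(`ExpMoments.integrable_mul_collRate`).

Let `G` be the sum of the gain and the loss term, so that `|Q(φ)| ≤ G`. The case `a = 1` shows that
`G` is integrable, which yields the absolute convergence of `Q(φ)`. Then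
`log (1 + G / φ) ≤ log (1 + G / ρ) + 1 + |U|` has all moments under `ρ`, and taking it for `a` gives
`∫ G log (1 + G / φ) < ∞` (`ExpMoments.integrable_collTotal_mul_log`). As
`Φ_*(y / 2) ≤ |y| log (1 + |y|)`, this is the finiteness of the modular of `Q(φ) / φ`. The field is
centered because the collision map exchanges gain and loss (`ExpMoments.integral_boltzmannQ`).
-/

noncomputable section

namespace InfoGeom

/-! ### The collision map -/

theorem inner_collV_sub_collW (x : S2) (v w : Vel) :
    inner ℝ (x : Vel) (collV x v w - collW x v w) = -inner ℝ (x : Vel) (v - w) := by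
  have hx : inner ℝ (x : Vel) (x : Vel) = 1 := by
    rw [real_inner_self_eq_norm_sq, norm_eq_of_mem_sphere x, one_pow]
  simp only [collV, collW, inner_sub_right, inner_add_right, inner_smul_right, hx]
  ring

theorem collV_collV_collW (x : S2) (v w : Vel) : collV x (collV x v w) (collW x v w) = v := by
  rw [collV, inner_collV_sub_collW, collV]
  module

theorem collW_collV_collW (x : S2) (v w : Vel) : collW x (collV x v w) (collW x v w) = w := by
  rw [collW, inner_collV_sub_collW, collW]
  module

/-- Conservation of kinetic energy. -/
theorem norm_sq_collV_add_norm_sq_collW (x : S2) (v w : Vel) :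
    ‖collV x v w‖ ^ 2 + ‖collW x v w‖ ^ 2 = ‖v‖ ^ 2 + ‖w‖ ^ 2 := by
  have hx : ‖(x : Vel)‖ = 1 := norm_eq_of_mem_sphere x
  rw [collV, collW, norm_sub_sq_real, norm_add_sq_real]
  simp only [inner_smul_right, norm_smul, hx, mul_one, Real.norm_eq_abs, sq_abs]
  rw [real_inner_comm (x : Vel) v, real_inner_comm (x : Vel) w, inner_sub_right]
  ring

theorem stdNormal_collV_mul_stdNormal_collW (x : S2) (v w : Vel) :
    stdNormal (collV x v w) * stdNormal (collW x v w) = stdNormal v * stdNormal w := by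
  have h := norm_sq_collV_add_norm_sq_collW x v w
  simp only [stdNormal]
  rw [mul_mul_mul_comm, mul_mul_mul_comm _ _ _ (Real.exp (-‖w‖ ^ 2 / 2)), ← Real.exp_add,
    ← Real.exp_add]
  congr 2
  linarith

/-- The collision with parameter `x`, as a linear endomorphism of the space of pairs of
velocities. -/
def collLin (x : S2) : Vel × Vel →ₗ[ℝ] Vel × Vel where
  toFun p := (collV x p.1 p.2, collW x p.1 p.2)
  map_add' p q := by
    ext1 <;> simp only [collV, collW, inner_sub_right, inner_add_right, Prod.fst_add,
      Prod.snd_add] <;> module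
  map_smul' c p := by
    ext1 <;> simp only [collV, collW, inner_sub_right, inner_smul_right, Prod.smul_fst,
      Prod.smul_snd, RingHom.id_apply] <;> module

/-- A collision is an involution, so its determinant is `±1` and it preserves volume. -/
theorem map_collLin (x : S2) :
    Measure.map (collLin x) ((volume : Measure Vel).prod volume) =
      (volume : Measure Vel).prod volume := by
  have hinv : collLin x ∘ₗ collLin x = LinearMap.id := by
    ext1 <;> ext1 p <;>
      exact Prod.ext (collV_collV_collW x _ _) (collW_collV_collW x _ _)
  have hsq : LinearMap.det (collLin x) * LinearMap.det (collLin x) = 1 := by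
    rw [← LinearMap.det_comp, hinv, LinearMap.det_id]
  have habs : |LinearMap.det (collLin x)| = 1 := by
    rcases mul_self_eq_one_iff.1 hsq with h | h <;> simp [h]
  have hne : LinearMap.det (collLin x) ≠ 0 := fun h => by simp [h] at hsq
  rw [Measure.map_linearMap_addHaar_eq_smul_addHaar _ hne, abs_inv, habs]
  simp

/-- The collision map `(v, w, x) ↦ (v_x, w_x, x)`. -/
def collide (z : Vel × Vel × S2) : Vel × Vel × S2 :=
  (collV z.2.2 z.1 z.2.1, collW z.2.2 z.1 z.2.1, z.2.2)

theorem continuous_collide : Continuous collide := by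
  unfold collide collV collW
  fun_prop

theorem collide_collide (z : Vel × Vel × S2) : collide (collide z) = z :=
  Prod.ext (collV_collV_collW _ _ _) (Prod.ext (collW_collV_collW _ _ _) rfl)

/-- The measure `dv dw σ(dx)`. -/
def collMeasure : Measure (Vel × Vel × S2) := volume.prod (volume.prod sphereUnif)

theorem measurePreserving_collide : MeasurePreserving collide collMeasure collMeasure := by
  have hS : MeasurePreserving (fun p : S2 × (Vel × Vel) => (p.1, collLin p.1 p.2))
      (sphereUnif.prod (volume.prod volume)) (sphereUnif.prod (volume.prod volume)) := by
    refine (MeasurePreserving.id sphereUnif).skew_product (g := fun x p => collLin x p) ?_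
      (ae_of_all _ map_collLin)
    refine Continuous.measurable ?_
    change Continuous fun p : S2 × (Vel × Vel) => (collV p.1 p.2.1 p.2.2, collW p.1 p.2.1 p.2.2)
    unfold collV collW
    fun_prop
  have hA := measurePreserving_prodAssoc (volume : Measure Vel) (volume : Measure Vel) sphereUnif
  have hswap := Measure.measurePreserving_swap (μ := sphereUnif)
    (ν := (volume : Measure Vel).prod (volume : Measure Vel))
  have hswap' := Measure.measurePreserving_swap (ν := sphereUnif)
    (μ := (volume : Measure Vel).prod (volume : Measure Vel))
  exact ((hA.comp hswap).comp hS).comp (hswap'.comp (hA.symm MeasurableEquiv.prodAssoc))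

/-- The collision kernel `|x'(v - w)|`. -/
def collKernel (z : Vel × Vel × S2) : ℝ := |inner ℝ (z.2.2 : Vel) (z.1 - z.2.1)|

theorem continuous_collKernel : Continuous collKernel := by
  unfold collKernel
  fun_prop

theorem collKernel_nonneg (z : Vel × Vel × S2) : 0 ≤ collKernel z := abs_nonneg _

theorem collKernel_collide (z : Vel × Vel × S2) : collKernel (collide z) = collKernel z := by
  simp only [collKernel, collide, inner_collV_sub_collW, abs_neg]

theorem collKernel_le (z : Vel × Vel × S2) : collKernel z ≤ ‖z.1‖ + ‖z.2.1‖ := by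
  refine (abs_real_inner_le_norm _ _).trans ?_
  rw [norm_eq_of_mem_sphere z.2.2, one_mul]
  exact norm_sub_le _ _

/-- The product `φ(v) φ(w)`, as a function of `(v, w, x)`. -/
def tensorSq (φ : Vel → ℝ) (z : Vel × Vel × S2) : ℝ := φ z.1 * φ z.2.1

theorem tensorSq_stdNormal_collide (z : Vel × Vel × S2) :
    tensorSq stdNormal (collide z) = tensorSq stdNormal z :=
  stdNormal_collV_mul_stdNormal_collW _ _ _

theorem boltzmannIntegrand_eq (φ : Vel → ℝ) (z : Vel × Vel × S2) :
    boltzmannIntegrand φ z.1 z.2.1 z.2.2 =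
      (tensorSq φ (collide z) - tensorSq φ z) * collKernel z := rfl

theorem integrable_mul_mul {a b : Vel → ℝ} (ha : Integrable a) (hb : Integrable b) :
    Integrable (fun z : Vel × Vel × S2 => a z.1 * b z.2.1) collMeasure :=
  ha.mul_prod (hb.comp_fst sphereUnif)

theorem integrable_comp_collide {H : Vel × Vel × S2 → ℝ} (hH : Integrable H collMeasure) :
    Integrable (fun z => H (collide z)) collMeasure :=
  (measurePreserving_collide.integrable_comp hH.aestronglyMeasurable).2 hH

theorem integral_comp_collide {H : Vel × Vel × S2 → ℝ} (hH : Integrable H collMeasure) :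
    ∫ z, H (collide z) ∂collMeasure = ∫ z, H z ∂collMeasure := by
  have h := integral_map (μ := collMeasure) continuous_collide.measurable.aemeasurable
    (f := H) (by rw [measurePreserving_collide.map_eq]; exact hH.aestronglyMeasurable)
  rw [← h, measurePreserving_collide.map_eq]

/-! ### The Boltzmann operator and changes of representative -/

theorem tensorSq_congr_ae {g φ : Vel → ℝ} (h : g =ᵐ[volume] φ) :
    ∀ᵐ z ∂collMeasure, tensorSq g z = tensorSq φ z := by
  have h1 : ∀ᵐ z ∂collMeasure, g z.1 = φ z.1 := Measure.quasiMeasurePreserving_fst.ae h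
  have h2 : ∀ᵐ z ∂collMeasure, g z.2.1 = φ z.2.1 :=
    (Measure.quasiMeasurePreserving_fst.comp Measure.quasiMeasurePreserving_snd).ae h
  filter_upwards [h1, h2] with z h1 h2
  rw [tensorSq, tensorSq, h1, h2]

theorem ae_boltzmannIntegrand_eq {g φ : Vel → ℝ} (h : g =ᵐ[volume] φ) :
    ∀ᵐ v : Vel, ∀ᵐ z : Vel × S2 ∂(volume.prod sphereUnif),
      boltzmannIntegrand g v z.1 z.2 = boltzmannIntegrand φ v z.1 z.2 := by
  have h1 := tensorSq_congr_ae h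
  have h2 := measurePreserving_collide.quasiMeasurePreserving.ae h1
  refine Measure.ae_ae_of_ae_prod (p := fun z : Vel × Vel × S2 =>
    boltzmannIntegrand g z.1 z.2.1 z.2.2 = boltzmannIntegrand φ z.1 z.2.1 z.2.2) ?_
  change ∀ᵐ z ∂collMeasure, _
  filter_upwards [h1, h2] with z h1 h2
  rw [boltzmannIntegrand_eq, boltzmannIntegrand_eq, h1, h2]

theorem boltzmannQ_congr_ae {g φ : Vel → ℝ} (h : g =ᵐ[volume] φ) :
    boltzmannQ g =ᵐ[volume] boltzmannQ φ := by
  filter_upwards [ae_boltzmannIntegrand_eq h] with v hv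
  refine integral_congr_ae ?_
  filter_upwards [Measure.ae_ae_of_ae_prod hv] with w hw
  exact integral_congr_ae hw

/-! ### Elementary inequalities and Gaussian moments -/

theorem pow_le_mul_exp {t δ : ℝ} (ht : 0 ≤ t) (hδ : 0 < δ) (n : ℕ) :
    t ^ n ≤ n.factorial / δ ^ n * Real.exp (δ * t) := by
  have h := Real.pow_div_factorial_le_exp (δ * t) (by positivity) n
  rw [div_le_iff₀ (by positivity), mul_pow] at h
  rw [div_mul_eq_mul_div, le_div_iff₀ (by positivity)]
  linarith

/-- Young's inequality for the conjugate exponents `1 + 1 / m` and `m + 1`, without the optimal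
constants: one of the two terms dominates, according to whether `X` or `e^(S / m)` is larger. -/
theorem mul_exp_le {X : ℝ} (hX : 0 ≤ X) (S : ℝ) {m : ℕ} (hm : m ≠ 0) :
    X * Real.exp S ≤ Real.exp ((1 + 1 / m) * S) + X ^ (m + 1) := by
  have hm' : (m : ℝ) ≠ 0 := Nat.cast_ne_zero.2 hm
  rcases le_total X (Real.exp (1 / m * S)) with h | h
  · have : X * Real.exp S ≤ Real.exp ((1 + 1 / m) * S) := by
      rw [add_mul, one_mul, add_comm, Real.exp_add]
      gcongr
    linarith [pow_nonneg hX (m + 1)]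
  · have : Real.exp S ≤ X ^ m := by
      calc Real.exp S = Real.exp (1 / m * S) ^ m := by
            rw [← Real.exp_nat_mul]; congr 1; field_simp
        _ ≤ X ^ m := by gcongr
    have : X * Real.exp S ≤ X ^ (m + 1) := by
      rw [pow_succ']; gcongr
    linarith [Real.exp_pos ((1 + 1 / m) * S)]

/-- The factor `1 / 2` is admissible because membership in an Orlicz space only requires the modular
to be finite after some scaling; it makes the bound free of constants. -/
theorem coshConj_half_le {y : ℝ} (hy : 0 ≤ y) : coshConj (1 / 2 * y) ≤ y * Real.log (1 + y) := by
  rw [coshConj_eq]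
  have h1 : 1 ≤ √(1 + (1 / 2 * y) ^ 2) := Real.one_le_sqrt.2 (by nlinarith [sq_nonneg y])
  have h2 : √(1 + (1 / 2 * y) ^ 2) ≤ 1 + 1 / 2 * y :=
    Real.sqrt_le_iff.2 ⟨by positivity, by nlinarith⟩
  have h3 : Real.arsinh (1 / 2 * y) ≤ Real.log (1 + y) := by
    unfold Real.arsinh
    exact Real.log_le_log (by positivity) (by linarith)
  have h4 : 0 ≤ Real.log (1 + y) := Real.log_nonneg (by linarith)
  have h5 := mul_le_mul_of_nonneg_left h3 (show 0 ≤ 1 / 2 * y by positivity)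
  nlinarith [mul_nonneg hy h4]

theorem integrable_stdNormal : Integrable stdNormal := by
  by_contra h
  have := integral_undef h
  rw [integral_stdNormal] at this
  exact one_ne_zero this

theorem integrable_norm_pow_mul_stdNormal (n : ℕ) :
    Integrable fun v : Vel => ‖v‖ ^ (2 * n) * stdNormal v := by
  have hg : Integrable fun v : Vel => Real.exp (-(1 / 4) * ‖v‖ ^ 2) := by
    by_contra h
    have h1 := GaussianFourier.integral_rexp_neg_mul_sq_norm (V := Vel) (b := 1 / 4) (by norm_num)
    rw [integral_undef h] at h1
    have : (0 : ℝ) < (Real.pi / (1 / 4)) ^ (Module.finrank ℝ Vel / 2 : ℝ) := by positivity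
    exact this.ne h1
  refine (hg.const_mul (n.factorial / (1 / 4) ^ n * (2 * Real.pi) ^ (-(3 / 2) : ℝ))).mono'
    ((by fun_prop : Continuous fun v : Vel => ‖v‖ ^ (2 * n)).mul
      continuous_stdNormal).aestronglyMeasurable (ae_of_all _ fun v => ?_)
  rw [Real.norm_of_nonneg (mul_nonneg (by positivity) (stdNormal_pos v).le), stdNormal, pow_mul]
  calc (‖v‖ ^ 2) ^ n * ((2 * Real.pi) ^ (-(3 / 2) : ℝ) * Real.exp (-‖v‖ ^ 2 / 2))
      ≤ (n.factorial / (1 / 4) ^ n * Real.exp (1 / 4 * ‖v‖ ^ 2)) *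
        ((2 * Real.pi) ^ (-(3 / 2) : ℝ) * Real.exp (-‖v‖ ^ 2 / 2)) := by
        gcongr
        exact pow_le_mul_exp (by positivity) (by norm_num) n
    _ = n.factorial / (1 / 4) ^ n * (2 * Real.pi) ^ (-(3 / 2) : ℝ) *
        (Real.exp (1 / 4 * ‖v‖ ^ 2) * Real.exp (-‖v‖ ^ 2 / 2)) := by ring
    _ = _ := by
        rw [← Real.exp_add]
        congr 2
        ring

/-! ### Integrability of the collision term -/

/-- The density `e^U ρ`, where `ρ` is the standard normal density. -/
def tilt (U : Vel → ℝ) (v : Vel) : ℝ := Real.exp (U v) * stdNormal v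

theorem tilt_pos (U : Vel → ℝ) (v : Vel) : 0 < tilt U v :=
  mul_pos (Real.exp_pos _) (stdNormal_pos v)

/-- `U` is measurable, `e^U` has a moment of order `1 + 1 / m` with respect to the standard normal
law, and `|U|` has an exponential moment of order `δ`. -/
structure ExpMoments (U : Vel → ℝ) (m : ℕ) (δ : ℝ) : Prop where
  measurable : Measurable U
  ne_zero : m ≠ 0
  pos : 0 < δ
  integrable_exp : Integrable fun v => Real.exp ((1 + 1 / m) * U v) * stdNormal v
  integrable_exp_abs : Integrable fun v => Real.exp (δ * |U v|) * stdNormal v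

/-- The total collision rate `(φ(v_x) φ(w_x) + φ(v) φ(w)) |x'(v - w)|`: the sum of gain and loss. -/
def collRate (φ : Vel → ℝ) (z : Vel × Vel × S2) : ℝ :=
  (tensorSq φ (collide z) + tensorSq φ z) * collKernel z

/-- The sum of the gain and the loss part of the Boltzmann operator. -/
def collTotal (φ : Vel → ℝ) (v : Vel) : ℝ :=
  ∫ z, collRate φ (v, z) ∂((volume : Measure Vel).prod sphereUnif)

theorem tensorSq_tilt (U : Vel → ℝ) (z : Vel × Vel × S2) :
    tensorSq (tilt U) z = Real.exp (U z.1 + U z.2.1) * tensorSq stdNormal z := by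
  simp only [tensorSq, tilt, Real.exp_add]
  ring

theorem tensorSq_stdNormal_pos (z : Vel × Vel × S2) : 0 < tensorSq stdNormal z :=
  mul_pos (stdNormal_pos _) (stdNormal_pos _)

theorem tensorSq_tilt_pos (U : Vel → ℝ) (z : Vel × Vel × S2) : 0 < tensorSq (tilt U) z :=
  mul_pos (tilt_pos _ _) (tilt_pos _ _)

theorem measurable_tensorSq {φ : Vel → ℝ} (h : Measurable φ) : Measurable (tensorSq φ) := by
  unfold tensorSq
  fun_prop

theorem measurable_collRate {φ : Vel → ℝ} (h : Measurable φ) : Measurable (collRate φ) :=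
  (((measurable_tensorSq h).comp continuous_collide.measurable).add (measurable_tensorSq h)).mul
    continuous_collKernel.measurable

theorem measurable_collTotal {φ : Vel → ℝ} (h : Measurable φ) : Measurable (collTotal φ) :=
  (measurable_collRate h).stronglyMeasurable.integral_prod_right'.measurable

theorem collRate_tilt_nonneg (U : Vel → ℝ) (z : Vel × Vel × S2) : 0 ≤ collRate (tilt U) z :=
  mul_nonneg (add_pos (tensorSq_tilt_pos _ _) (tensorSq_tilt_pos _ _)).le (collKernel_nonneg z)

theorem collTotal_tilt_nonneg (U : Vel → ℝ) (v : Vel) : 0 ≤ collTotal (tilt U) v :=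
  integral_nonneg fun _ => collRate_tilt_nonneg _ _

namespace ExpMoments

variable {U : Vel → ℝ} {m : ℕ} {δ : ℝ}

theorem measurable_tilt (hU : ExpMoments U m δ) : Measurable (tilt U) :=
  hU.measurable.exp.mul continuous_stdNormal.measurable

/-- Hölder's inequality, in the form of a pointwise Young inequality: `e^U ⊗ e^U` has a moment of
order `1 + 1 / m`, whose conjugate exponent is `m + 1`. -/
theorem integrable_mul_tensorSq (hU : ExpMoments U m δ) {A : Vel × Vel × S2 → ℝ}
    (hA : Measurable A) (hA0 : ∀ z, 0 ≤ A z)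
    (hi : Integrable (fun z => A z ^ (m + 1) * tensorSq stdNormal z) collMeasure) :
    Integrable (fun z => A z * tensorSq (tilt U) z) collMeasure := by
  refine ((integrable_mul_mul hU.integrable_exp hU.integrable_exp).add hi).mono'
    (hA.mul (measurable_tensorSq hU.measurable_tilt)).aestronglyMeasurable
    (ae_of_all _ fun z => ?_)
  rw [Real.norm_of_nonneg (mul_nonneg (hA0 z) (tensorSq_tilt_pos _ _).le)]
  calc A z * tensorSq (tilt U) z
      = A z * Real.exp (U z.1 + U z.2.1) * tensorSq stdNormal z := by
        rw [tensorSq_tilt, mul_assoc]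
    _ ≤ (Real.exp ((1 + 1 / m) * (U z.1 + U z.2.1)) + A z ^ (m + 1)) * tensorSq stdNormal z :=
        mul_le_mul_of_nonneg_right (mul_exp_le (hA0 z) _ hU.ne_zero) (tensorSq_stdNormal_pos z).le
    _ = _ := by
        simp only [Pi.add_apply, mul_add, Real.exp_add, tensorSq]
        ring

theorem integrable_mul_collKernel_mul_tensorSq (hU : ExpMoments U m δ) {A : Vel × Vel × S2 → ℝ}
    (hA : Measurable A) (hA0 : ∀ z, 0 ≤ A z)
    (hi : Integrable (fun z => A z ^ (2 * (m + 1)) * tensorSq stdNormal z) collMeasure) :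
    Integrable (fun z => A z * collKernel z * tensorSq (tilt U) z) collMeasure := by
  have hk := continuous_collKernel.measurable
  refine hU.integrable_mul_tensorSq (hA.mul hk)
    (fun z => mul_nonneg (hA0 z) (collKernel_nonneg z)) ?_
  have hn := integrable_norm_pow_mul_stdNormal (m + 1)
  have h1 := integrable_mul_mul hn integrable_stdNormal
  have h2 := integrable_mul_mul integrable_stdNormal hn
  refine (hi.add ((h1.add h2).const_mul (2 ^ (2 * (m + 1) - 1)))).mono'
    (((hA.mul hk).pow_const _).mul
      (measurable_tensorSq continuous_stdNormal.measurable)).aestronglyMeasurable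
    (ae_of_all _ fun z => ?_)
  have hρ := tensorSq_stdNormal_pos z
  have hpos : 0 ≤ (A z * collKernel z) ^ (m + 1) :=
    pow_nonneg (mul_nonneg (hA0 z) (collKernel_nonneg z)) _
  rw [Real.norm_of_nonneg (mul_nonneg hpos hρ.le)]
  have hsq : (A z * collKernel z) ^ (m + 1) ≤
      A z ^ (2 * (m + 1)) + collKernel z ^ (2 * (m + 1)) := by
    rw [mul_pow, mul_comm 2, pow_mul, pow_mul]
    nlinarith [sq_nonneg (A z ^ (m + 1) - collKernel z ^ (m + 1)),
      sq_nonneg (A z ^ (m + 1)), sq_nonneg (collKernel z ^ (m + 1))]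
  have hker : collKernel z ^ (2 * (m + 1)) ≤
      2 ^ (2 * (m + 1) - 1) * (‖z.1‖ ^ (2 * (m + 1)) + ‖z.2.1‖ ^ (2 * (m + 1))) :=
    (pow_le_pow_left₀ (collKernel_nonneg z) (collKernel_le z) _).trans
      (add_pow_le (norm_nonneg _) (norm_nonneg _) _)
  calc (A z * collKernel z) ^ (m + 1) * tensorSq stdNormal z
      ≤ (A z ^ (2 * (m + 1)) +
          2 ^ (2 * (m + 1) - 1) * (‖z.1‖ ^ (2 * (m + 1)) + ‖z.2.1‖ ^ (2 * (m + 1)))) *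
          tensorSq stdNormal z :=
        mul_le_mul_of_nonneg_right (hsq.trans (by linarith)) hρ.le
    _ = _ := by
        simp only [Pi.add_apply, tensorSq]
        ring

/-- A function of `v` whose moment of order `2 (m + 1)` under the normal law is finite is integrable
against the collision rate. For the gain part, the collision map moves the collided velocities from
the density to the test function, where they do no harm because the product of the normal laws is
invariant. -/
theorem integrable_mul_collRate (hU : ExpMoments U m δ) {a : Vel → ℝ} (ha : Measurable a)
    (ha0 : ∀ v, 0 ≤ a v) (hi : Integrable fun v => a v ^ (2 * (m + 1)) * stdNormal v) :
    Integrable (fun z => a z.1 * collRate (tilt U) z) collMeasure := by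
  have h1 : Integrable (fun z => a z.1 ^ (2 * (m + 1)) * tensorSq stdNormal z) collMeasure := by
    simpa only [tensorSq, mul_assoc] using integrable_mul_mul hi integrable_stdNormal
  have h2 : Integrable (fun z => a (collide z).1 ^ (2 * (m + 1)) * tensorSq stdNormal z)
      collMeasure := by
    simpa only [tensorSq_stdNormal_collide] using integrable_comp_collide h1
  have hloss := hU.integrable_mul_collKernel_mul_tensorSq (ha.comp measurable_fst)
    (fun z => ha0 z.1) h1
  have hgain := integrable_comp_collide (hU.integrable_mul_collKernel_mul_tensorSq
    (ha.comp (measurable_fst.comp continuous_collide.measurable))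
    (fun z => ha0 (collide z).1) h2)
  refine (hgain.add hloss).congr (ae_of_all _ fun z => ?_)
  simp only [Pi.add_apply, Function.comp_apply, collide_collide, collKernel_collide, collRate]
  ring

theorem integrable_collRate (hU : ExpMoments U m δ) :
    Integrable (collRate (tilt U)) collMeasure := by
  simpa using hU.integrable_mul_collRate (a := fun _ => 1) measurable_const
    (fun _ => zero_le_one) (by simpa using integrable_stdNormal)

theorem integrable_collTotal (hU : ExpMoments U m δ) : Integrable (collTotal (tilt U)) :=
  Integrable.integral_prod_left hU.integrable_collRate

/-- With `G = collTotal φ` and `φ = e^U ρ`, the function `log (1 + G / φ)` has all moments under the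
normal law `ρ`: it is at most `log (1 + G / ρ) + 1 + |U|`, where `G` is integrable and `|U|` has an
exponential moment. -/
theorem integrable_log_pow (hU : ExpMoments U m δ) (n : ℕ) :
    Integrable fun v =>
      Real.log (1 + collTotal (tilt U) v / tilt U v) ^ n * stdNormal v := by
  have hG := measurable_collTotal hU.measurable_tilt
  refine (((integrable_stdNormal.add hU.integrable_collTotal).const_mul
    (2 ^ (n - 1) * (n.factorial / 1 ^ n))).add (hU.integrable_exp_abs.const_mul
      (2 ^ (n - 1) * (n.factorial / δ ^ n * Real.exp δ)))).mono'
    ((((hG.div hU.measurable_tilt).const_add 1).log.pow_const n).mul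
      continuous_stdNormal.measurable).aestronglyMeasurable (ae_of_all _ fun v => ?_)
  have hρ := stdNormal_pos v
  have hG0 := collTotal_tilt_nonneg U v
  have ha : 0 ≤ collTotal (tilt U) v / stdNormal v := by positivity
  have hlog0 : 0 ≤ Real.log (1 + collTotal (tilt U) v / tilt U v) :=
    Real.log_nonneg (by linarith [div_nonneg hG0 (tilt_pos U v).le])
  rw [Real.norm_of_nonneg (mul_nonneg (pow_nonneg hlog0 n) hρ.le)]
  have hla : 0 ≤ Real.log (1 + collTotal (tilt U) v / stdNormal v) :=
    Real.log_nonneg (by linarith)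
  have hsplit : Real.log (1 + collTotal (tilt U) v / tilt U v) ≤
      Real.log (1 + collTotal (tilt U) v / stdNormal v) + (1 + |U v|) := by
    have he : (1 : ℝ) ≤ Real.exp (1 + |U v|) := Real.one_le_exp (by positivity)
    have he' : Real.exp (-U v) ≤ Real.exp (1 + |U v|) :=
      Real.exp_le_exp.2 (by linarith [neg_abs_le (U v)])
    rw [← Real.log_exp (1 + |U v|), ← Real.log_mul (by positivity) (Real.exp_pos _).ne']
    refine Real.log_le_log (by linarith [div_nonneg hG0 (tilt_pos U v).le]) ?_
    have : collTotal (tilt U) v / tilt U v =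
        collTotal (tilt U) v / stdNormal v * Real.exp (-U v) := by
      rw [tilt, Real.exp_neg]
      field_simp
    rw [this, add_mul, one_mul]
    exact add_le_add he (mul_le_mul_of_nonneg_left he' ha)
  have h1 : Real.log (1 + collTotal (tilt U) v / stdNormal v) ^ n ≤
      n.factorial / 1 ^ n * (1 + collTotal (tilt U) v / stdNormal v) := by
    refine (pow_le_mul_exp hla one_pos n).trans_eq ?_
    rw [one_mul, Real.exp_log (by linarith)]
  have h2 : (1 + |U v|) ^ n ≤ n.factorial / δ ^ n * Real.exp δ * Real.exp (δ * |U v|) := by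
    refine (pow_le_mul_exp (by positivity) hU.pos n).trans_eq ?_
    rw [mul_add, mul_one, Real.exp_add, mul_assoc]
  calc Real.log (1 + collTotal (tilt U) v / tilt U v) ^ n * stdNormal v
      ≤ 2 ^ (n - 1) * (n.factorial / 1 ^ n * (1 + collTotal (tilt U) v / stdNormal v) +
          n.factorial / δ ^ n * Real.exp δ * Real.exp (δ * |U v|)) * stdNormal v := by
        refine mul_le_mul_of_nonneg_right ?_ hρ.le
        refine (pow_le_pow_left₀ hlog0 hsplit n).trans ((add_pow_le hla (by positivity) n).trans ?_)
        gcongr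
    _ = _ := by
        simp only [Pi.add_apply]
        field_simp

/-- The entropy bound `∫ G log (1 + G / φ) < ∞`. -/
theorem integrable_collTotal_mul_log (hU : ExpMoments U m δ) :
    Integrable fun v =>
      collTotal (tilt U) v * Real.log (1 + collTotal (tilt U) v / tilt U v) := by
  have hG := measurable_collTotal hU.measurable_tilt
  have h := hU.integrable_mul_collRate (((hG.div hU.measurable_tilt).const_add 1).log)
    (fun v => Real.log_nonneg (le_add_of_nonneg_right
      (div_nonneg (collTotal_tilt_nonneg U v) (tilt_pos U v).le)))
    (hU.integrable_log_pow _)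
  refine (Integrable.integral_prod_left h).congr (ae_of_all _ fun v => ?_)
  simp only [integral_const_mul]
  exact mul_comm _ _

/-! ### The Boltzmann field along a tilted normal density -/

theorem integrable_boltzmannIntegrand (hU : ExpMoments U m δ) :
    Integrable (fun z => boltzmannIntegrand (tilt U) z.1 z.2.1 z.2.2) collMeasure := by
  have hφ := measurable_tensorSq hU.measurable_tilt
  refine hU.integrable_collRate.mono' (((hφ.comp continuous_collide.measurable).sub hφ).mul
    continuous_collKernel.measurable).aestronglyMeasurable (ae_of_all _ fun z => ?_)
  rw [boltzmannIntegrand_eq, norm_mul, Real.norm_of_nonneg (collKernel_nonneg z), collRate,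
    Real.norm_eq_abs]
  refine mul_le_mul_of_nonneg_right ?_ (collKernel_nonneg z)
  refine abs_le.2 ⟨?_, ?_⟩ <;>
    linarith [tensorSq_tilt_pos U z, tensorSq_tilt_pos U (collide z)]

theorem ae_integrable_boltzmannIntegrand (hU : ExpMoments U m δ) :
    ∀ᵐ v : Vel, Integrable (fun z : Vel × S2 => boltzmannIntegrand (tilt U) v z.1 z.2)
      (volume.prod sphereUnif) :=
  Integrable.prod_right_ae hU.integrable_boltzmannIntegrand

/-- The iterated integral in the definition of `boltzmannQ` is the integral over the product
space. -/
theorem boltzmannQ_ae_eq (hU : ExpMoments U m δ) :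
    boltzmannQ (tilt U) =ᵐ[volume] fun v =>
      ∫ z : Vel × S2, boltzmannIntegrand (tilt U) v z.1 z.2 ∂(volume.prod sphereUnif) := by
  filter_upwards [hU.ae_integrable_boltzmannIntegrand] with v hv
  exact (integral_prod _ hv).symm

/-- Holds only almost everywhere: where the collision rate is not integrable, `collTotal` has the
junk value `0`. -/
theorem abs_boltzmannQ_le (hU : ExpMoments U m δ) :
    ∀ᵐ v : Vel, |boltzmannQ (tilt U) v| ≤ collTotal (tilt U) v := by
  filter_upwards [hU.boltzmannQ_ae_eq, Integrable.prod_right_ae hU.integrable_collRate]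
    with v hv hi
  rw [hv, ← Real.norm_eq_abs]
  refine norm_integral_le_of_norm_le hi (ae_of_all _ fun z => ?_)
  have h := boltzmannIntegrand_eq (tilt U) (v, z)
  simp only at h
  rw [h, norm_mul, Real.norm_of_nonneg (collKernel_nonneg _), collRate, Real.norm_eq_abs]
  refine mul_le_mul_of_nonneg_right ?_ (collKernel_nonneg _)
  refine abs_le.2 ⟨?_, ?_⟩ <;>
    linarith [tensorSq_tilt_pos U (v, z), tensorSq_tilt_pos U (collide (v, z))]

theorem integrable_boltzmannQ (hU : ExpMoments U m δ) : Integrable (boltzmannQ (tilt U)) :=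
  (Integrable.integral_prod_left hU.integrable_boltzmannIntegrand).congr hU.boltzmannQ_ae_eq.symm

/-- Conservation of mass: gain and loss are exchanged by the collision map. -/
theorem integral_boltzmannQ (hU : ExpMoments U m δ) : ∫ v, boltzmannQ (tilt U) v = 0 := by
  have hloss : Integrable (fun z => tensorSq (tilt U) z * collKernel z) collMeasure := by
    have h := hU.integrable_mul_collKernel_mul_tensorSq (A := fun _ => 1) measurable_const
      (fun _ => zero_le_one)
      (by simpa [tensorSq] using integrable_mul_mul integrable_stdNormal integrable_stdNormal)
    exact h.congr (ae_of_all _ fun z => by ring)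
  rw [integral_congr_ae hU.boltzmannQ_ae_eq]
  have h := integral_prod _ hU.integrable_boltzmannIntegrand
  rw [← h]
  change ∫ z, boltzmannIntegrand (tilt U) z.1 z.2.1 z.2.2 ∂collMeasure = 0
  simp only [boltzmannIntegrand_eq, sub_mul]
  have hgain := integrable_comp_collide hloss
  have heq := integral_comp_collide hloss
  simp only [collKernel_collide] at hgain heq
  rw [integral_sub hgain hloss, heq, sub_self]

end ExpMoments

/-! ### Densities of the maximal exponential model at the normal law -/

theorem maxwellian_measure :
    maxwellian.measure = volume.withDensity fun v => ENNReal.ofReal (stdNormal v) :=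
  withDensity_congr_ae ((AEEqFun.coeFn_mk stdNormal
    continuous_stdNormal.aestronglyMeasurable).mono fun _ hv => congrArg ENNReal.ofReal hv)

theorem integrable_mul_stdNormal {g : Vel → ℝ} (hg : Measurable g) (hg0 : ∀ v, 0 ≤ g v)
    (hfin : ∫⁻ v, ENNReal.ofReal (g v) ∂maxwellian.measure < ⊤) :
    Integrable fun v => g v * stdNormal v := by
  have hi := (lintegral_ofReal_ne_top_iff_integrable hg.aestronglyMeasurable
    (ae_of_all _ hg0)).1 hfin.ne
  rw [maxwellian_measure, integrable_withDensity_iff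
    continuous_stdNormal.measurable.ennreal_ofReal
    (ae_of_all _ fun _ => ENNReal.ofReal_lt_top)] at hi
  refine hi.congr (ae_of_all _ fun v => ?_)
  simp only [ENNReal.toReal_ofReal (stdNormal_pos v).le]

/-- Since the cumulant domain is open, it contains `(1 + 1 / m) • u` for large `m`. -/
theorem exists_integrable_exp_of_mem_cumulantDomain {u : ExpSpace maxwellian}
    (hu : u ∈ cumulantDomain maxwellian) :
    ∃ m : ℕ, m ≠ 0 ∧
      Integrable fun v => Real.exp ((1 + 1 / m) * u.1 v) * stdNormal v := by
  have hc : Continuous fun t : ℝ => (1 + t) • u := by fun_prop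
  have hev : ∀ᶠ t : ℝ in nhds 0, (1 + t) • u ∈ cumulantDomain maxwellian :=
    hc.continuousAt.eventually_mem (by
      rw [add_zero, one_smul]
      exact isOpen_interior.mem_nhds hu)
  obtain ⟨n, hn⟩ := (tendsto_one_div_add_atTop_nhds_zero_nat.eventually hev).exists
  refine ⟨n + 1, n.succ_ne_zero, ?_⟩
  have hlt : cumulant maxwellian ((1 + 1 / ((n : ℝ) + 1)) • u) < ⊤ :=
    interior_subset (s := {u | cumulant maxwellian u < ⊤}) hn
  rw [cumulant, ENNReal.log_lt_top_iff] at hlt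
  push_cast
  refine integrable_mul_stdNormal (u.1.toAEEqFun.measurable.const_mul _).exp
    (fun v => (Real.exp_pos _).le) (lt_of_eq_of_lt (lintegral_congr_ae ?_) hlt)
  filter_upwards [OrliczSpace.coeFn_smul (1 + 1 / ((n : ℝ) + 1)) u.1] with v hv
  rw [Submodule.coe_smul, hv]

theorem exists_integrable_exp_abs (u : OrliczSpace youngCosh maxwellian.measure) :
    ∃ δ : ℝ, 0 < δ ∧ Integrable fun v => Real.exp (δ * |u v|) * stdNormal v := by
  obtain ⟨δ, hδ, hfin⟩ := u.exists_modular_lt_top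
  have hm : Measurable u := u.toAEEqFun.measurable
  have hi := integrable_mul_stdNormal
    (youngCosh.continuous.measurable.comp (hm.const_mul δ))
    (fun v => youngCosh.nonneg (δ * u v)) hfin
  refine ⟨δ, hδ, ((hi.add integrable_stdNormal).const_mul 2).mono'
    (((hm.abs.const_mul δ).exp).mul
      continuous_stdNormal.measurable).aestronglyMeasurable (ae_of_all _ fun v => ?_)⟩
  have hρ := stdNormal_pos v
  rw [Real.norm_of_nonneg (mul_pos (Real.exp_pos _) hρ).le]
  have hle : Real.exp (δ * |u v|) ≤ 2 * Real.cosh (δ * u v) := by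
    rw [← Real.cosh_abs, abs_mul, abs_of_pos hδ, Real.cosh_eq]
    linarith [Real.exp_pos (-(δ * |u v|))]
  refine (mul_le_mul_of_nonneg_right hle hρ.le).trans_eq ?_
  simp only [Pi.add_apply, Function.comp_apply, youngCosh]
  ring

theorem exists_expMoments_of_mem_maxExp {f : PosDensity (volume : Measure Vel)}
    (hf : f ∈ maxExp maxwellian) :
    ∃ (U : Vel → ℝ) (m : ℕ) (δ : ℝ), ExpMoments U m δ ∧ f =ᵐ[volume] tilt U := by
  obtain ⟨u, hu, hfu⟩ := hf
  obtain ⟨m, hm, hexp⟩ := exists_integrable_exp_of_mem_cumulantDomain hu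
  obtain ⟨δ, hδ, habs⟩ := exists_integrable_exp_abs u.1
  set K := (cumulant maxwellian u).toReal
  have hmeas : Measurable u.1 := u.1.toAEEqFun.measurable
  have hmeasU : Measurable fun v => u.1 v - K := hmeas.sub_const K
  refine ⟨fun v => u.1 v - K, m, δ, ⟨hmeasU, hm, hδ, ?_, ?_⟩, ?_⟩
  · refine (hexp.const_mul (Real.exp (-((1 + 1 / m) * K)))).congr (ae_of_all _ fun v => ?_)
    simp only
    rw [← mul_assoc, ← Real.exp_add]
    congr 2
    ring
  · refine (habs.const_mul (Real.exp (δ * |K|))).mono'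
      (((hmeasU.abs.const_mul δ).exp).mul
        continuous_stdNormal.measurable).aestronglyMeasurable (ae_of_all _ fun v => ?_)
    have hρ := stdNormal_pos v
    rw [Real.norm_of_nonneg (mul_pos (Real.exp_pos _) hρ).le, ← mul_assoc, ← Real.exp_add]
    gcongr
    rw [← mul_add, add_comm]
    exact mul_le_mul_of_nonneg_left (abs_sub _ _) hδ.le
  · filter_upwards [hfu, AEEqFun.coeFn_mk stdNormal continuous_stdNormal.aestronglyMeasurable]
      with v h1 h2
    rw [h1]
    exact congrArg _ h2

theorem PosDensity.aemeasurable_ofReal {Ω : Type*} [MeasurableSpace Ω] {μ : Measure Ω}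
    (p : PosDensity μ) : AEMeasurable (fun ω => ENNReal.ofReal (p ω)) μ :=
  p.toAEEqFun.measurable.ennreal_ofReal.aemeasurable

theorem PosDensity.absolutelyContinuous_measure {Ω : Type*} [MeasurableSpace Ω] {μ : Measure Ω}
    (p : PosDensity μ) : μ ≪ p.measure :=
  withDensity_absolutelyContinuous' p.aemeasurable_ofReal
    (p.pos.mono fun _ h => (ENNReal.ofReal_pos.2 h).ne')

/-- The Boltzmann field at a density `e^U ρ` with exponential moments, as an element of the fiber of
the pretangent bundle. -/
theorem exists_pretangent_of_expMoments {f : PosDensity (volume : Measure Vel)} {U : Vel → ℝ}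
    {m : ℕ} {δ : ℝ} (hU : ExpMoments U m δ) (hf : f =ᵐ[volume] tilt U) :
    ∃ b : PretangentSpace f, b.1 =ᵐ[volume] fun v => boltzmannQ (tilt U) v / tilt U v := by
  set q : Vel → ℝ := fun v => boltzmannQ (tilt U) v / tilt U v
  have hqm : AEStronglyMeasurable q volume :=
    (hU.integrable_boltzmannQ.aestronglyMeasurable.aemeasurable.div
      hU.measurable_tilt.aemeasurable).aestronglyMeasurable
  have hqm' : AEStronglyMeasurable q f.measure :=
    hqm.mono_ac (withDensity_absolutelyContinuous _ _)
  have hmk := AEEqFun.coeFn_mk q hqm'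
  have hfin : modular youngCoshStar f.measure (fun v => 1 / 2 * q v) < ⊤ := by
    unfold modular PosDensity.measure
    rw [lintegral_withDensity_eq_lintegral_mul₀ f.aemeasurable_ofReal
      (g := fun v => ENNReal.ofReal (youngCoshStar (1 / 2 * q v)))
      (youngCoshStar.continuous.measurable.comp_aemeasurable
        (hqm.aemeasurable.const_mul _)).ennreal_ofReal]
    refine lt_of_le_of_lt (lintegral_mono_ae ?_)
      hU.integrable_collTotal_mul_log.lintegral_lt_top
    filter_upwards [hf, hU.abs_boltzmannQ_le] with v hfv hQ
    have hφ := tilt_pos U v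
    rw [Pi.mul_apply, hfv, ← ENNReal.ofReal_mul hφ.le]
    refine ENNReal.ofReal_le_ofReal ?_
    have hq : |q v| ≤ collTotal (tilt U) v / tilt U v := by
      rw [abs_div, abs_of_pos hφ]
      gcongr
    have hlog : |q v| * Real.log (1 + |q v|) ≤ collTotal (tilt U) v / tilt U v *
        Real.log (1 + collTotal (tilt U) v / tilt U v) := by
      have h0 := abs_nonneg (q v)
      have h1 := h0.trans hq
      gcongr
      exact Real.log_nonneg (by linarith)
    have habs : youngCoshStar (1 / 2 * q v) = coshConj (1 / 2 * |q v|) := by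
      rw [← youngCoshStar.map_abs, abs_mul, abs_of_pos (by norm_num : (0 : ℝ) < 1 / 2)]
      rfl
    rw [habs]
    calc tilt U v * coshConj (1 / 2 * |q v|)
        ≤ tilt U v * (collTotal (tilt U) v / tilt U v *
            Real.log (1 + collTotal (tilt U) v / tilt U v)) := by
          gcongr
          exact (coshConj_half_le (abs_nonneg _)).trans hlog
      _ = _ := by
          rw [← mul_assoc, mul_div_cancel₀ _ hφ.ne']
  have hfq : ∀ᵐ v, (ENNReal.ofReal (f v)).toReal • q v = boltzmannQ (tilt U) v := by
    filter_upwards [hf] with v hv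
    have hφ := tilt_pos U v
    rw [hv, ENNReal.toReal_ofReal hφ.le, smul_eq_mul, mul_div_cancel₀ _ hφ.ne']
  have hint : Integrable q f.measure :=
    (integrable_withDensity_iff_integrable_smul₀' f.aemeasurable_ofReal
      (ae_of_all _ fun _ => ENNReal.ofReal_lt_top)).2
      (hU.integrable_boltzmannQ.congr (hfq.mono fun _ h => h.symm))
  have hzero : ∫ v, q v ∂f.measure = 0 := by
    rw [PosDensity.measure, integral_withDensity_eq_integral_toReal_smul₀ f.aemeasurable_ofReal
      (ae_of_all _ fun _ => ENNReal.ofReal_lt_top), integral_congr_ae hfq, hU.integral_boltzmannQ]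
  refine ⟨⟨OrliczSpace.mk (AEEqFun.mk q hqm') ⟨1 / 2, by norm_num, ?_⟩, ?_, ?_⟩, ?_⟩
  · exact (modular_congr _ (hmk.mono fun v hv => congrArg (1 / 2 * ·) hv)).trans_lt hfin
  · exact hint.congr hmk.symm
  · exact (integral_congr_ae hmk).trans hzero
  · exact f.absolutelyContinuous_measure.ae_le hmk

theorem boltzmannQ_div_congr_ae {g φ : Vel → ℝ} (h : g =ᵐ[volume] φ) :
    (fun v => boltzmannQ g v / g v) =ᵐ[volume] fun v => boltzmannQ φ v / φ v := by
  filter_upwards [boltzmannQ_congr_ae h, h] with v h1 h2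
  rw [h1, h2]

/-- The Boltzmann field at a point of the maximal exponential model; it is given by every
representative of the density. -/
theorem exists_pretangent_of_mem_maxExp {f : PosDensity (volume : Measure Vel)}
    (hf : f ∈ maxExp maxwellian) :
    ∃ b : PretangentSpace f, ∀ g : Vel → ℝ, g =ᵐ[volume] f →
      b.1 =ᵐ[volume] fun v => boltzmannQ g v / g v := by
  obtain ⟨U, m, δ, hU, hfU⟩ := exists_expMoments_of_mem_maxExp hf
  obtain ⟨b, hb⟩ := exists_pretangent_of_expMoments hU hfU
  exact ⟨b, fun g hg => hb.trans (boltzmannQ_div_congr_ae (hg.trans hfU)).symm⟩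

theorem ae_integrable_boltzmannIntegrand_of_mem_maxExp {f : PosDensity (volume : Measure Vel)}
    (hf : f ∈ maxExp maxwellian) {g : Vel → ℝ} (hg : g =ᵐ[volume] f) :
    ∀ᵐ v : Vel, Integrable (fun z : Vel × S2 => boltzmannIntegrand g v z.1 z.2)
      (volume.prod sphereUnif) := by
  obtain ⟨U, m, δ, hU, hfU⟩ := exists_expMoments_of_mem_maxExp hf
  filter_upwards [hU.ae_integrable_boltzmannIntegrand, ae_boltzmannIntegrand_eq (hg.trans hfU)]
    with v h1 h2
  exact h1.congr (h2.mono fun _ h => h.symm)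

end InfoGeom

end

theorem mainTheorem1 :
    (∀ f ∈ maxExp maxwellian, ∀ g : Vel → ℝ, g =ᵐ[MeasureTheory.volume] f →
      (∀ᵐ v : Vel, MeasureTheory.Integrable
        (fun z : Vel × S2 => boltzmannIntegrand g v z.1 z.2)
        (MeasureTheory.volume.prod sphereUnif)) ∧
      ∃ b : PretangentSpace f,
        b.1 =ᵐ[MeasureTheory.volume] fun v => boltzmannQ g v / g v) ∧
    ∃ F : PretangentField (maxExp maxwellian),
      ∀ (f : maxExp maxwellian) (g : Vel → ℝ), g =ᵐ[MeasureTheory.volume] f.1 →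
        (F.toFun f).2.1 =ᵐ[MeasureTheory.volume] fun v => boltzmannQ g v / g v := by
  choose! b hb using
    fun f : maxExp maxwellian => exists_pretangent_of_mem_maxExp f.2
  exact ⟨fun f hf g hg => ⟨ae_integrable_boltzmannIntegrand_of_mem_maxExp hf hg,
    b ⟨f, hf⟩, hb ⟨f, hf⟩ g hg⟩, ⟨fun f => ⟨f.1, b f⟩, fun _ => rfl⟩, hb⟩
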